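/- Let $d$ be a positive integer. For a partition $\mu$ of a positive integer $n$ let $S^\mu$ be the irreducible complex representation (Specht module) of the symmetric group $S_n$ corresponding to $\mu$, let $\chi^\mu$ be its character, and for $\nu\vdash n$ let $C_\nu\subseteq S_n$ be the conjugacy class of permutations of cycle type $\nu$. A secondary partition $\omega=[\mu_1,\dots,\mu_n]\vdash\vdash d$ is a multiset of partitions $\mu_j\vdash d_j$ of positive integers $d_j$ with $d_1+\dots+d_n=d$; let $p_2(d)$ be the number of secondary partitions of $d$. If $n_1,\dots,n_m$ are the multiplicities of the distinct members of $\omega$, put $$r(\omega)=\frac{(-1)^{n-1}}{n}\cdot\frac{n!}{n_1!\cdots n_m!}\prod_{j=1}^n\left(\frac{\dim S^{\mu_j}}{d_j!}\right)^2 ,$$ and for $i\in\{1,2,3\}$ and indeterminates $t_{i,1},\dots,t_{i,d}$ put $$s(\omega;t_{i,1},\dots,t_{i,d})=\prod_{j=1}^n\ \sum_{\nu\vdash d_j}\frac{\chi^{\mu_j}(C_\nu)\,|C_\nu|}{\dim S^{\mu_j}}\,\mathbf t_i^{\nu},\qquad \mathbf t_i^{\nu}=t_{i,a_1}\cdots t_{i,a_r}\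 \text{ for }\nu=[a_1,\dots,a_r].$$ Let Zheng's realizability polynomial for three branch points be $$F_{d,3}(\mathbf t)=\sum_{\omega\vdash\vdash d} r(\omega)\prod_{i=1}^{3}s(\omega;t_{i,1},\dots,t_{i,d}).$$ Then every coefficient of $F_{d,3}$ is a rational number that can be written over the common denominator $(d!)^4$, i.e. as $N/(d!)^4$ with $N\in\mathbb Z$, and this numerator satisfies $|N|\le p_2(d)\cdot(d!)^8$. -/

import Mathlib

open scoped Nat

namespace Hurwitz

/-! ### Specht modules and irreducible characters of the symmetric group -/

/-- Write `0, 1, 2, …` row by row, left to right, into left-aligned rows of lengths `L`.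
`rowOf L i` is the (zero-based) index of the row that contains `i`. -/
def rowOf : List ℕ → ℕ → ℕ
  | [], _ => 0
  | a :: L, i => if i < a then 0 else rowOf L (i - a) + 1

/-- Same filling as in `rowOf`: `colOf L i` is the (zero-based) index of the column that
contains `i`. -/
def colOf : List ℕ → ℕ → ℕ
  | [], i => i
  | a :: L, i => if i < a then i else colOf L (i - a)

/-- The row lengths of the Young diagram of `μ`: its parts in weakly decreasing order. -/
def rowLens {n : ℕ} (μ : n.Partition) : List ℕ := μ.parts.sort (· ≥ ·)

/-- The permutations preserving each row of the row-reading Young tableau of shape `μ`. -/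
def rowGroup {n : ℕ} (μ : n.Partition) : Finset (Equiv.Perm (Fin n)) :=
  Finset.univ.filter fun σ => ∀ i, rowOf (rowLens μ) (σ i) = rowOf (rowLens μ) i

/-- The permutations preserving each column of the row-reading Young tableau of shape `μ`. -/
def colGroup {n : ℕ} (μ : n.Partition) : Finset (Equiv.Perm (Fin n)) :=
  Finset.univ.filter fun σ => ∀ i, colOf (rowLens μ) (σ i) = colOf (rowLens μ) i

/-- The Young symmetrizer `c_μ = (∑_{p ∈ R} p) (∑_{q ∈ C} sgn(q) q)` in `ℂ[S_n]`, where `R` and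
`C` are the row and column groups of the row-reading tableau. -/
noncomputable def youngSymmetrizer {n : ℕ} (μ : n.Partition) :
    MonoidAlgebra ℂ (Equiv.Perm (Fin n)) :=
  (∑ p ∈ rowGroup μ, MonoidAlgebra.single p (1 : ℂ)) *
    (∑ q ∈ colGroup μ, MonoidAlgebra.single q (((Equiv.Perm.sign q : ℤ) : ℂ)))

/-- The underlying space of the Specht module `S^μ`: the left ideal `ℂ[S_n] c_μ`. -/
noncomputable abbrev SpechtModule {n : ℕ} (μ : n.Partition) :
    Submodule (MonoidAlgebra ℂ (Equiv.Perm (Fin n))) (MonoidAlgebra ℂ (Equiv.Perm (Fin n))) :=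
  Submodule.span (MonoidAlgebra ℂ (Equiv.Perm (Fin n))) {youngSymmetrizer μ}

/-- The irreducible representation `S^μ` of `S_n`: left multiplication on `ℂ[S_n] c_μ`. -/
noncomputable def specht {n : ℕ} (μ : n.Partition) :
    Representation ℂ (Equiv.Perm (Fin n)) (SpechtModule μ) :=
  Representation.ofModule' (SpechtModule μ)

/-- `dim S^μ`. -/
noncomputable def spechtDim {n : ℕ} (μ : n.Partition) : ℕ :=
  Module.finrank ℂ (SpechtModule μ)

/-- The conjugacy class `C_ν ⊆ S_n` of all permutations of cycle type `ν` (fixed points are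
recorded as parts equal to `1`). -/
def conjClass {n : ℕ} (ν : n.Partition) : Finset (Equiv.Perm (Fin n)) :=
  Finset.univ.filter fun σ => σ.partition.parts = ν.parts

theorem conjClass_nonempty {n : ℕ} (ν : n.Partition) : (conjClass ν).Nonempty := by
  have hsum : (ν.parts.filter (2 ≤ ·)).sum + (ν.parts.filter (¬ 2 ≤ ·)).sum = n := by
    rw [← Multiset.sum_add, Multiset.filter_add_not, ν.parts_sum]
  obtain ⟨g, hg⟩ := (Equiv.Perm.exists_with_cycleType_iff (Fin n)
    (m := ν.parts.filter (2 ≤ ·))).2 ⟨by rw [Fintype.card_fin]; omega, by simp⟩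
  refine ⟨g, ?_⟩
  have h1 : ν.parts.filter (¬ 2 ≤ ·) =
      Multiset.replicate (Multiset.card (ν.parts.filter (¬ 2 ≤ ·))) 1 := by
    refine Multiset.eq_replicate_card.2 fun b hb => ?_
    have h := Multiset.mem_filter.1 hb
    have := ν.parts_pos h.1
    omega
  have h2 : (ν.parts.filter (¬ 2 ≤ ·)).sum = Multiset.card (ν.parts.filter (¬ 2 ≤ ·)) := by
    rw [h1]; simp
  have h3 : Fintype.card (Fin n) - g.support.card =
      Multiset.card (ν.parts.filter (¬ 2 ≤ ·)) := by
    rw [← Equiv.Perm.sum_cycleType, hg, Fintype.card_fin]; omega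
  simp only [conjClass, Finset.mem_filter, Finset.mem_univ, true_and]
  rw [Equiv.Perm.parts_partition, hg, h3, ← h1, Multiset.filter_add_not]

/-- `χ^μ(C_ν)`, the value of the character of `S^μ` at an element of `C_ν`. -/
noncomputable def charValue {n : ℕ} (μ ν : n.Partition) : ℂ :=
  (specht μ).character (conjClass_nonempty ν).choose

/-- The choice of the element of `C_ν` in `charValue` is immaterial. -/
theorem charValue_eq {n : ℕ} (μ ν : n.Partition) {g : Equiv.Perm (Fin n)}
    (hg : g ∈ conjClass ν) : (specht μ).character g = charValue μ ν := by
  have h := (conjClass_nonempty ν).choose_spec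
  simp only [conjClass, Finset.mem_filter, Finset.mem_univ, true_and] at hg h
  have hc : IsConj (conjClass_nonempty ν).choose g :=
    Equiv.Perm.partition_eq_of_isConj.2 (Nat.Partition.ext (h.trans hg.symm))
  obtain ⟨c, hc⟩ := isConj_iff.1 hc
  rw [charValue, ← hc, Representation.char_conj]

/-! ### Secondary partitions and the realizability polynomial -/

/-- A secondary partition `ω = [μ₁, …, μ_n] ⊢⊢ d`: a multiset of partitions `μ_j` of positive
integers `d_j` with `d₁ + ⋯ + d_n = d`. An element of `parts` is a pair `⟨d_j, μ_j⟩`. -/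
@[ext]
structure SecondaryPartition (d : ℕ) where
  parts : Multiset (Σ e : ℕ, e.Partition)
  pos : ∀ p ∈ parts, 0 < p.1
  sum_eq : (parts.map Sigma.fst).sum = d

namespace SecondaryPartition

instance instFinite (d : ℕ) : Finite (SecondaryPartition d) := by
  classical
  let B : Multiset (Σ e : ℕ, e.Partition) :=
    d • ((Finset.range (d + 1)).sigma fun e => (Finset.univ : Finset e.Partition)).val
  have hle : ∀ ω : SecondaryPartition d, ω.parts ≤ B := by
    intro ω
    rw [Multiset.le_iff_count]
    intro p
    by_cases hp : p ∈ ω.parts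
    · have hpd : p.1 ≤ d := by
        have := Multiset.single_le_sum (s := ω.parts.map Sigma.fst) (fun _ _ => Nat.zero_le _)
          p.1 (Multiset.mem_map_of_mem _ hp)
        rwa [ω.sum_eq] at this
      have hcard : Multiset.card ω.parts ≤ d := by
        have := Multiset.card_nsmul_le_sum (s := ω.parts.map Sigma.fst) (a := 1) (by
          intro x hx
          obtain ⟨q, hq, rfl⟩ := Multiset.mem_map.1 hx
          exact ω.pos q hq)
        simpa [ω.sum_eq] using this
      have hB : Multiset.count p B = d := by
        rw [Multiset.count_nsmul, Multiset.count_eq_one_of_mem (Finset.nodup _)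
          (Finset.mem_def.1 (Finset.mem_sigma.2
            ⟨Finset.mem_range.2 (Nat.lt_succ_of_le hpd), Finset.mem_univ _⟩)), mul_one]
      rw [hB]
      exact (Multiset.count_le_card _ _).trans hcard
    · rw [Multiset.count_eq_zero_of_notMem hp]
      exact Nat.zero_le _
  exact Finite.of_injective (β := {s // s ∈ B.powerset.toFinset})
    (fun ω => ⟨ω.parts, by simpa using hle ω⟩)
    fun ω₁ ω₂ h => SecondaryPartition.ext (congrArg Subtype.val h)

noncomputable instance instFintype (d : ℕ) : Fintype (SecondaryPartition d) := Fintype.ofFinite _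

end SecondaryPartition

/-- `p₂(d)`, the number of secondary partitions of `d`. -/
noncomputable def p₂ (d : ℕ) : ℕ := Nat.card (SecondaryPartition d)

open Classical in
/-- The coefficient
`r(ω) = ((-1)^(n-1) / n) * (n! / (n₁! ⋯ n_m!)) * ∏_j (dim S^{μ_j} / d_j!)^2`, where `n` is the
number of parts of `ω` and `n₁, …, n_m` are the multiplicities of its distinct parts. -/
noncomputable def rCoeff {d : ℕ} (ω : SecondaryPartition d) : ℂ :=
  ((-1) ^ (Multiset.card ω.parts - 1) / (Multiset.card ω.parts : ℂ)) *
    (((Multiset.card ω.parts)! : ℂ) /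
      ∏ p ∈ ω.parts.toFinset, ((Multiset.count p ω.parts)! : ℂ)) *
    (ω.parts.map fun p => ((spechtDim p.2 : ℂ) / (p.1 ! : ℂ)) ^ 2).prod

/-- The polynomial `s(ω; t_{i,1}, …, t_{i,d})`. The variable `t_{i,a}` is
`MvPolynomial.X (i, a)`; only those with `1 ≤ a ≤ d` occur. -/
noncomputable def sPoly {d : ℕ} (k : ℕ) (ω : SecondaryPartition d) (i : Fin k) :
    MvPolynomial (Fin k × ℕ) ℂ :=
  (ω.parts.map fun p => ∑ ν : p.1.Partition,
    MvPolynomial.C (charValue p.2 ν * ((conjClass ν).card : ℂ) / (spechtDim p.2 : ℂ)) *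
      (ν.parts.map fun a => (MvPolynomial.X (i, a) : MvPolynomial (Fin k × ℕ) ℂ)).prod).prod

/-- Zheng's realizability polynomial `F_{d,k}`. -/
noncomputable def realizabilityPoly (d k : ℕ) : MvPolynomial (Fin k × ℕ) ℂ :=
  ∑ ω : SecondaryPartition d, MvPolynomial.C (rCoeff ω) * ∏ i : Fin k, sPoly k ω i

end Hurwitz

namespace Hurwitz

/-! ### Tableau combinatorics -/

/-! The proof rests on the central characters `χ^μ(C_ν) |C_ν| / dim S^μ` being integers of absolute
value at most `|C_ν|`, which follows directly from the Young symmetrizer `c`. A class sum `z` is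
central, so `z c` is still fixed by row permutations on the left and multiplied by the sign under
column permutations on the right. By von Neumann's lemma (`eq_smul_youngSymmetrizer_of_symmetry`) it
is a scalar multiple of `c`. Since `c` has coefficient 1 at the identity, the scalar is the
coefficient of `z c` there: a sum of `|C_ν|` coefficients of `c`, each 0 or ±1. Taking traces on
`S^μ` identifies this scalar with the central character (`exists_int_centralCharacter`).

Hence `s(ω; t_i)` has integer coefficients, dominated by those of the polynomial with class sizes in
place of central characters. The value of that polynomial at all ones is at most `∏ d_j! ≤ d!`, so
the three factors contribute at most `(d!)^3`. Both `n` and `∏ d_j!` divide `d!`, so `r(ω)` has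
denominator `(d!)^4` with numerator at most `(d!)^5` (`exists_int_rCoeff`). Summing over the `p₂(d)`
secondary partitions gives the bound. -/

theorem rowOf_colOf_injective (L : List ℕ) {i j : ℕ} (hr : rowOf L i = rowOf L j)
    (hc : colOf L i = colOf L j) : i = j := by
  induction L generalizing i j with
  | nil => exact hc
  | cons a L ih =>
    simp only [rowOf, colOf] at hr hc
    split_ifs at hr hc with h1 h2 h2
    · exact hc
    · have := ih (Nat.succ_injective hr) hc
      omega

theorem exists_mem_colOf_lt {L : List ℕ} {i : ℕ} (hi : i < L.sum) : ∃ b ∈ L, colOf L i < b := by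
  induction L generalizing i with
  | nil => simp at hi
  | cons a L ih =>
    by_cases h : i < a
    · exact ⟨a, by simp, by simp [colOf, h]⟩
    · rw [List.sum_cons] at hi
      obtain ⟨b, hb, hlt⟩ := ih (i := i - a) (by omega)
      exact ⟨b, by simp [hb], by simpa [colOf, h] using hlt⟩

/-- The diagram of a weakly decreasing list is closed under moving up within a column. -/
theorem exists_rowOf_eq_of_le {L : List ℕ} (hL : L.Pairwise (· ≥ ·)) {i r : ℕ} (hi : i < L.sum)
    (hr : r ≤ rowOf L i) : ∃ j < L.sum, rowOf L j = r ∧ colOf L j = colOf L i := by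
  induction L generalizing i r with
  | nil => simp at hi
  | cons a L ih =>
    rw [List.pairwise_cons] at hL
    by_cases h : i < a
    · simp only [rowOf, h, if_true, Nat.le_zero] at hr
      exact ⟨i, hi, by simp [rowOf, h, hr], rfl⟩
    · rw [List.sum_cons] at hi
      simp only [rowOf, h, if_false] at hr
      rcases r with _ | r
      -- The column of `i` is shorter than some later row, hence than the first row; there the entry
      -- in column `c` is `c` itself.
      · obtain ⟨b, hb, hlt⟩ := exists_mem_colOf_lt (L := L) (i := i - a) (by omega)
        have := hL.1 b hb
        have hlt' : colOf L (i - a) < a := by omega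
        refine ⟨colOf L (i - a), by rw [List.sum_cons]; omega, ?_, ?_⟩
        · simp [rowOf, hlt']
        · simp [colOf, hlt', h]
      · obtain ⟨j, hj, h1, h2⟩ := ih hL.2 (i := i - a) (r := r) (by omega) (by omega)
        refine ⟨a + j, by rw [List.sum_cons]; omega, ?_, ?_⟩
        · simp [rowOf, h1]
        · simp [colOf, h, h2]

/-- A finite set of cells with the same row and column sizes as a diagram is that diagram. Here
the cells of the diagram are `(row x, col x)` and those of the other set are `(row x, col (g x))`. -/
theorem exists_row_eq_col_eq {X : Type*} [Finite X] {row col : X → ℕ}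
    (hinj : ∀ x y, row x = row y → col x = col y → x = y)
    (hdown : ∀ x, ∀ r ≤ row x, ∃ y, row y = r ∧ col y = col x) (g : Equiv.Perm X)
    (hg : ∀ x y, row x = row y → col (g x) = col (g y) → x = y) (x : X) :
    ∃ y, row y = row x ∧ col y = col (g x) := by
  suffices H : ∀ k, ∀ x, row x < k → ∃ y, row y = row x ∧ col y = col (g x) from
    H _ x (Nat.lt_succ_self _)
  intro k
  induction k with
  | zero => intro x hx; omega
  | succ k ih =>
    intro x hx
    by_contra hno
    have hxk : row x = k := by
      by_contra hne
      exact hno (ih x (by omega))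
    -- If the column of `g x` reached row `k`, its cell in that row would be the one sought.
    have hcol : ∀ y, col y = col (g x) → row y < k := by
      intro y hy
      by_contra hlt
      obtain ⟨y', h1, h2⟩ := hdown y k (by omega)
      exact hno ⟨y', by rw [h1, hxk], by rw [h2, hy]⟩
    choose f hf using fun z : {z // row z < k} => ih z.1 z.2
    have hF : Function.Injective
        (fun z : {z // row z < k} => (⟨f z, by rw [(hf z).1]; exact z.2⟩ : {z // row z < k})) := by
      intro z w hzw
      have hzw' : f z = f w := congrArg Subtype.val hzw
      refine Subtype.ext (hg _ _ ?_ ?_)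
      · rw [← (hf z).1, ← (hf w).1, hzw']
      · rw [← (hf z).2, ← (hf w).2, hzw']
    -- By induction `f` permutes the cells in rows above `k`, so each of them has the form `(row z,
    -- col (g z))`.
    have hsurj := Finite.injective_iff_surjective.1 hF
    have hsec : ∀ y : {y // col y = col (g x)}, ∃ z, row z = row y.1 ∧ col (g z) = col y.1 := by
      intro y
      obtain ⟨z, hz⟩ := hsurj ⟨y.1, hcol _ y.2⟩
      have hz' : f z = y.1 := congrArg Subtype.val hz
      exact ⟨z.1, by rw [← hz', (hf z).1], by rw [← hz', (hf z).2]⟩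
    choose s hs using hsec
    -- The map `y ↦ g (s y)` is injective on the finite column of `g x`, so it attains `g x`. Then
    -- `x = s y` lies in the row of `y`, above row `k`: a contradiction.
    have hS : Function.Injective (fun y : {y // col y = col (g x)} =>
        (⟨g (s y), by rw [(hs y).2]; exact y.2⟩ : {y // col y = col (g x)})) := by
      intro y w hyw
      have h : s y = s w := g.injective (congrArg Subtype.val hyw)
      refine Subtype.ext (hinj _ _ ?_ (y.2.trans w.2.symm))
      rw [← (hs y).1, ← (hs w).1, h]
    obtain ⟨y, hy⟩ := Finite.injective_iff_surjective.1 hS ⟨g x, rfl⟩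
    have hy' : s y = x := g.injective (congrArg Subtype.val hy)
    have h1 := hcol y.1 y.2
    rw [← (hs y).1, hy'] at h1
    omega

section Tableau

variable {n : ℕ} (μ : n.Partition)

theorem rowLens_sum : (rowLens μ).sum = n := by
  rw [← Multiset.sum_coe, rowLens, Multiset.sort_eq, μ.parts_sum]

theorem rowLens_pairwise : (rowLens μ).Pairwise (· ≥ ·) :=
  Multiset.pairwise_sort _ _

variable {μ}

theorem mem_rowGroup {σ : Equiv.Perm (Fin n)} :
    σ ∈ rowGroup μ ↔ ∀ i, rowOf (rowLens μ) (σ i) = rowOf (rowLens μ) i := by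
  simp [rowGroup]

theorem mem_colGroup {σ : Equiv.Perm (Fin n)} :
    σ ∈ colGroup μ ↔ ∀ i, colOf (rowLens μ) (σ i) = colOf (rowLens μ) i := by
  simp [colGroup]

theorem mul_mem_rowGroup {σ τ : Equiv.Perm (Fin n)} (hσ : σ ∈ rowGroup μ) (hτ : τ ∈ rowGroup μ) :
    σ * τ ∈ rowGroup μ := by
  rw [mem_rowGroup] at *
  intro i
  rw [Equiv.Perm.mul_apply, hσ, hτ]

theorem mul_mem_colGroup {σ τ : Equiv.Perm (Fin n)} (hσ : σ ∈ colGroup μ) (hτ : τ ∈ colGroup μ) :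
    σ * τ ∈ colGroup μ := by
  rw [mem_colGroup] at *
  intro i
  rw [Equiv.Perm.mul_apply, hσ, hτ]

theorem inv_mem_rowGroup {σ : Equiv.Perm (Fin n)} (hσ : σ ∈ rowGroup μ) : σ⁻¹ ∈ rowGroup μ := by
  rw [mem_rowGroup] at *
  intro i
  rw [← hσ (σ⁻¹ i)]
  simp

theorem inv_mem_colGroup {σ : Equiv.Perm (Fin n)} (hσ : σ ∈ colGroup μ) : σ⁻¹ ∈ colGroup μ := by
  rw [mem_colGroup] at *
  intro i
  rw [← hσ (σ⁻¹ i)]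
  simp

theorem one_mem_rowGroup : 1 ∈ rowGroup μ := mem_rowGroup.2 fun _ => rfl

theorem one_mem_colGroup : 1 ∈ colGroup μ := mem_colGroup.2 fun _ => rfl

theorem eq_one_of_mem_rowGroup_of_mem_colGroup {σ : Equiv.Perm (Fin n)} (hr : σ ∈ rowGroup μ)
    (hc : σ ∈ colGroup μ) : σ = 1 :=
  Equiv.ext fun i =>
    Fin.ext (rowOf_colOf_injective _ (mem_rowGroup.1 hr i) (mem_colGroup.1 hc i))

/-- A permutation is a product of a row and a column permutation unless two entries in the same
row of the tableau `T` lie in the same column of `g T`. -/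
theorem exists_mul_of_forall {g : Equiv.Perm (Fin n)}
    (hg : ∀ x y : Fin n, rowOf (rowLens μ) x = rowOf (rowLens μ) y →
      colOf (rowLens μ) (g⁻¹ x) = colOf (rowLens μ) (g⁻¹ y) → x = y) :
    ∃ p ∈ rowGroup μ, ∃ q ∈ colGroup μ, g = p * q := by
  have key := exists_row_eq_col_eq (X := Fin n) (row := fun x => rowOf (rowLens μ) x)
    (col := fun x => colOf (rowLens μ) x)
    (fun x y hr hc => Fin.ext (rowOf_colOf_injective _ hr hc))
    (fun x r hr => by
      obtain ⟨j, hj, h1, h2⟩ := exists_rowOf_eq_of_le (rowLens_pairwise μ) (i := x)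
        (by rw [rowLens_sum]; exact x.2) hr
      rw [rowLens_sum] at hj
      exact ⟨⟨j, hj⟩, h1, h2⟩) g⁻¹ hg
  choose f hf using key
  have hf_inj : Function.Injective f := by
    intro x y hxy
    refine hg x y ?_ ?_
    · rw [← (hf x).1, ← (hf y).1, hxy]
    · rw [← (hf x).2, ← (hf y).2, hxy]
  let p := Equiv.ofBijective f (Finite.injective_iff_bijective.1 hf_inj)
  have hp : p ∈ rowGroup μ := mem_rowGroup.2 fun i => (hf i).1
  -- `p` moves `x` within its row to the column of `g⁻¹ x`, so `p * g` preserves columns.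
  refine ⟨p⁻¹, inv_mem_rowGroup hp, p * g, mem_colGroup.2 fun i => ?_, by group⟩
  have h := (hf (g i)).2
  rw [show g⁻¹ (g i) = i by simp] at h
  exact h

/-- Some two distinct entries share a row of `T` and a column of `g T`; `t` is their transposition.
-/
theorem exists_swap_of_forall_ne {g : Equiv.Perm (Fin n)}
    (hg : ∀ p ∈ rowGroup μ, ∀ q ∈ colGroup μ, g ≠ p * q) :
    ∃ t ∈ rowGroup μ, g⁻¹ * t * g ∈ colGroup μ ∧ t * t = 1 ∧ Equiv.Perm.sign t = -1 := by
  by_contra hno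
  refine absurd (exists_mul_of_forall (μ := μ) (g := g) fun x y hr hc => ?_) (by push Not; exact hg)
  by_contra hne
  refine hno ⟨Equiv.swap x y, mem_rowGroup.2 fun i => ?_, mem_colGroup.2 fun i => ?_,
    Equiv.swap_mul_self x y, Equiv.Perm.sign_swap hne⟩
  · rw [Equiv.swap_apply_def]
    split_ifs with h1 h2
    · rw [h1, hr]
    · rw [h2, hr]
    · rfl
  · rw [Equiv.Perm.mul_apply, Equiv.Perm.mul_apply, Equiv.swap_apply_def]
    split_ifs with h1 h2
    · rw [← hc, ← h1]
      simp
    · rw [hc, ← h2]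
      simp
    · simp

end Tableau

/-! ### Class sums act on Specht modules by small integers -/

open MonoidAlgebra (single)

section Specht

variable {n : ℕ} {μ : n.Partition}

theorem single_mul_youngSymmetrizer {p : Equiv.Perm (Fin n)} (hp : p ∈ rowGroup μ) :
    single p (1 : ℂ) * youngSymmetrizer μ = youngSymmetrizer μ := by
  have h : single p (1 : ℂ) * ∑ r ∈ rowGroup μ, single r (1 : ℂ) =
      ∑ r ∈ rowGroup μ, single r (1 : ℂ) := by
    rw [Finset.mul_sum]
    refine Finset.sum_bij' (fun r _ => p * r) (fun r _ => p⁻¹ * r)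
      (fun r hr => mul_mem_rowGroup hp hr)
      (fun r hr => mul_mem_rowGroup (inv_mem_rowGroup hp) hr)
      (fun r _ => by group) (fun r _ => by group) fun r _ => ?_
    rw [MonoidAlgebra.single_mul_single, one_mul]
  rw [youngSymmetrizer, ← mul_assoc, h]

theorem youngSymmetrizer_mul_single {q : Equiv.Perm (Fin n)} (hq : q ∈ colGroup μ) :
    youngSymmetrizer μ * single q (1 : ℂ) =
      ((Equiv.Perm.sign q : ℤ) : ℂ) • youngSymmetrizer μ := by
  have h : (∑ r ∈ colGroup μ, single r ((Equiv.Perm.sign r : ℤ) : ℂ)) * single q (1 : ℂ) =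
      ((Equiv.Perm.sign q : ℤ) : ℂ) •
        ∑ r ∈ colGroup μ, single r ((Equiv.Perm.sign r : ℤ) : ℂ) := by
    rw [Finset.sum_mul, Finset.smul_sum]
    refine Finset.sum_bij' (fun r _ => r * q) (fun r _ => r * q⁻¹)
      (fun r hr => mul_mem_colGroup hr hq)
      (fun r hr => mul_mem_colGroup hr (inv_mem_colGroup hq))
      (fun r _ => by group) (fun r _ => by group) fun r _ => ?_
    rw [MonoidAlgebra.single_mul_single, MonoidAlgebra.smul_single, mul_one, smul_eq_mul]
    congr 1
    rcases Int.units_eq_one_or (Equiv.Perm.sign q) with h | h <;> simp [h]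
  rw [youngSymmetrizer, mul_assoc, h, mul_smul_comm]

/-- Row and column groups meet trivially, so `p * q = 1` only for `p = q = 1`. -/
theorem coeff_youngSymmetrizer_one : (youngSymmetrizer μ).coeff 1 = 1 := by
  classical
  rw [youngSymmetrizer, Finset.sum_mul_sum, MonoidAlgebra.coeff_sum, Finsupp.finsetSum_apply,
    Finset.sum_eq_single_of_mem 1 one_mem_rowGroup, MonoidAlgebra.coeff_sum,
    Finsupp.finsetSum_apply, Finset.sum_eq_single_of_mem 1 one_mem_colGroup]
  · simp [MonoidAlgebra.single_mul_single]
  · intro q _ hq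
    simp [MonoidAlgebra.single_mul_single, hq]
  · intro p hp hp1
    rw [MonoidAlgebra.coeff_sum, Finsupp.finsetSum_apply]
    refine Finset.sum_eq_zero fun q hq => ?_
    have : p * q ≠ 1 := by
      intro h
      rw [mul_eq_one_iff_eq_inv] at h
      exact hp1 (eq_one_of_mem_rowGroup_of_mem_colGroup hp (h ▸ inv_mem_colGroup hq))
    simp [MonoidAlgebra.single_mul_single, this]

theorem youngSymmetrizer_ne_zero : youngSymmetrizer μ ≠ 0 := by
  intro h
  simpa [h] using coeff_youngSymmetrizer_one (μ := μ)

section Symmetry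

variable {y : MonoidAlgebra ℂ (Equiv.Perm (Fin n))}
  (hrow : ∀ p ∈ rowGroup μ, single p (1 : ℂ) * y = y)
  (hcol : ∀ q ∈ colGroup μ, y * single q (1 : ℂ) = ((Equiv.Perm.sign q : ℤ) : ℂ) • y)
include hrow hcol

theorem coeff_mul_mul_of_symmetry {p q : Equiv.Perm (Fin n)} (hp : p ∈ rowGroup μ)
    (hq : q ∈ colGroup μ) (g : Equiv.Perm (Fin n)) :
    y.coeff (p * g * q) = ((Equiv.Perm.sign q : ℤ) : ℂ) * y.coeff g := by
  have h1 := congrArg (fun z => z.coeff (g * q)) (hrow _ (inv_mem_rowGroup hp))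
  have h2 := congrArg (fun z => z.coeff g) (hcol _ (inv_mem_colGroup hq))
  simp only [MonoidAlgebra.coeff_single_mul_apply, MonoidAlgebra.coeff_mul_single_apply, inv_inv,
    one_mul, mul_one, MonoidAlgebra.coeff_smul_apply, smul_eq_mul, Equiv.Perm.sign_inv] at h1 h2
  rw [mul_assoc, h1, h2]

/-- With `t` the transposition above, `g = t * g * (g⁻¹ * t * g)` and the last factor is an odd
column permutation, so the coefficient equals its own negative. -/
theorem coeff_eq_zero_of_symmetry {g : Equiv.Perm (Fin n)}
    (hg : ∀ p ∈ rowGroup μ, ∀ q ∈ colGroup μ, g ≠ p * q) : y.coeff g = 0 := by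
  obtain ⟨t, ht, hc, ht2, hsgn⟩ := exists_swap_of_forall_ne hg
  have h := coeff_mul_mul_of_symmetry hrow hcol ht hc g
  have e : t * g * (g⁻¹ * t * g) = g := by
    rw [show t * g * (g⁻¹ * t * g) = t * t * g by group, ht2, one_mul]
  have s : Equiv.Perm.sign (g⁻¹ * t * g) = -1 := by
    rw [map_mul, map_mul, hsgn, mul_right_comm, ← map_mul, inv_mul_cancel, map_one, one_mul]
  rw [e, s] at h
  push_cast at h
  linear_combination h / 2

/-- Von Neumann's lemma. -/
theorem eq_smul_youngSymmetrizer_of_symmetry : y = y.coeff 1 • youngSymmetrizer μ := by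
  refine MonoidAlgebra.coeff_injective (Finsupp.ext fun g => ?_)
  rw [MonoidAlgebra.coeff_smul_apply, smul_eq_mul]
  -- Both sides obey the same transformation rule: on products `p * q` the value at 1 determines
  -- them, elsewhere they vanish.
  by_cases hg : ∃ p ∈ rowGroup μ, ∃ q ∈ colGroup μ, g = p * q
  · obtain ⟨p, hp, q, hq, rfl⟩ := hg
    have h1 := coeff_mul_mul_of_symmetry hrow hcol hp hq 1
    have h2 := coeff_mul_mul_of_symmetry (μ := μ) (fun _ => single_mul_youngSymmetrizer)
      (fun _ => youngSymmetrizer_mul_single) hp hq 1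
    rw [mul_one] at h1 h2
    rw [h1, h2, coeff_youngSymmetrizer_one]
    ring
  · push Not at hg
    rw [coeff_eq_zero_of_symmetry hrow hcol hg,
      coeff_eq_zero_of_symmetry (fun _ => single_mul_youngSymmetrizer)
      (fun _ => youngSymmetrizer_mul_single) hg, mul_zero]

end Symmetry

theorem exists_int_coeff_youngSymmetrizer (μ : n.Partition) (g : Equiv.Perm (Fin n)) :
    ∃ a : ℤ, (youngSymmetrizer μ).coeff g = a ∧ |a| ≤ 1 := by
  by_cases hg : ∃ p ∈ rowGroup μ, ∃ q ∈ colGroup μ, g = p * q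
  · obtain ⟨p, hp, q, hq, rfl⟩ := hg
    have h := coeff_mul_mul_of_symmetry (μ := μ) (fun _ => single_mul_youngSymmetrizer)
      (fun _ => youngSymmetrizer_mul_single) hp hq 1
    rw [mul_one, coeff_youngSymmetrizer_one, mul_one] at h
    refine ⟨_, h, ?_⟩
    rcases Int.units_eq_one_or (Equiv.Perm.sign q) with h | h <;> simp [h]
  · push Not at hg
    exact ⟨0, by rw [coeff_eq_zero_of_symmetry (fun _ => single_mul_youngSymmetrizer)
      (fun _ => youngSymmetrizer_mul_single) hg, Int.cast_zero], by simp⟩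

/-- The class sum of `C_ν` in `ℂ[S_n]`. -/
noncomputable def classSum (ν : n.Partition) : MonoidAlgebra ℂ (Equiv.Perm (Fin n)) :=
  ∑ g ∈ conjClass ν, single g (1 : ℂ)

theorem conj_mem_conjClass {ν : n.Partition} {g : Equiv.Perm (Fin n)} (hg : g ∈ conjClass ν)
    (h : Equiv.Perm (Fin n)) : h * g * h⁻¹ ∈ conjClass ν := by
  simp only [conjClass, Finset.mem_filter, Finset.mem_univ, true_and] at hg ⊢
  rw [← hg, Equiv.Perm.partition_eq_of_isConj.1
    (isConj_iff.2 ⟨h, rfl⟩ : IsConj g (h * g * h⁻¹))]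

theorem single_mul_classSum (ν : n.Partition) (h : Equiv.Perm (Fin n)) :
    single h (1 : ℂ) * classSum ν = classSum ν * single h (1 : ℂ) := by
  rw [classSum, Finset.mul_sum, Finset.sum_mul]
  refine Finset.sum_bij' (fun g _ => h * g * h⁻¹) (fun g _ => h⁻¹ * g * h)
    (fun g hg => conj_mem_conjClass hg h)
    (fun g hg => by simpa using conj_mem_conjClass hg h⁻¹)
    (fun r _ => by group) (fun r _ => by group) fun r _ => ?_
  rw [MonoidAlgebra.single_mul_single, MonoidAlgebra.single_mul_single]
  congr 1
  group

theorem classSum_commute (ν : n.Partition) (x : MonoidAlgebra ℂ (Equiv.Perm (Fin n))) :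
    classSum ν * x = x * classSum ν := by
  induction x using MonoidAlgebra.induction_linear with
  | zero => simp
  | add x y hx hy => rw [mul_add, add_mul, hx, hy]
  | single g r =>
    have : (single g r : MonoidAlgebra ℂ (Equiv.Perm (Fin n))) = r • single g 1 := by
      simp [MonoidAlgebra.smul_single]
    rw [this, mul_smul_comm, smul_mul_assoc, single_mul_classSum]

/-- The class sum of `C_ν` multiplies the Young symmetrizer by an integer of absolute value at
most `|C_ν|`. -/
theorem exists_int_classSum_mul_youngSymmetrizer (μ ν : n.Partition) :
    ∃ a : ℤ, classSum ν * youngSymmetrizer μ = (a : ℂ) • youngSymmetrizer μ ∧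
      |a| ≤ (conjClass ν).card := by
  choose f hf hf1 using exists_int_coeff_youngSymmetrizer μ
  refine ⟨∑ g ∈ conjClass ν, f g⁻¹, ?_, (Finset.abs_sum_le_sum_abs _ _).trans ?_⟩
  · have h := eq_smul_youngSymmetrizer_of_symmetry (μ := μ) (y := classSum ν * youngSymmetrizer μ)
      (fun p hp => by
        rw [← mul_assoc, single_mul_classSum, mul_assoc, single_mul_youngSymmetrizer hp])
      (fun q hq => by rw [mul_assoc, youngSymmetrizer_mul_single hq, mul_smul_comm])
    have h1 : (classSum ν * youngSymmetrizer μ).coeff 1 =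
        ((∑ g ∈ conjClass ν, f g⁻¹ : ℤ) : ℂ) := by
      rw [classSum, Finset.sum_mul, MonoidAlgebra.coeff_sum, Finsupp.finsetSum_apply]
      push_cast
      exact Finset.sum_congr rfl fun g _ => by
        rw [MonoidAlgebra.coeff_single_mul_apply, one_mul, mul_one, hf]
    rw [h1] at h
    exact h
  · simpa using Finset.sum_le_card_nsmul (conjClass ν) (fun g => |f g⁻¹|) 1 fun g _ => hf1 _

/-- A central element acts on the whole left ideal by its scalar on the generator. -/
theorem classSum_mul_of_mem {ν : n.Partition} {a : ℂ}
    (ha : classSum ν * youngSymmetrizer μ = a • youngSymmetrizer μ)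
    {x : MonoidAlgebra ℂ (Equiv.Perm (Fin n))} (hx : x ∈ SpechtModule μ) :
    classSum ν * x = a • x := by
  obtain ⟨z, rfl⟩ := Submodule.mem_span_singleton.1 hx
  rw [smul_eq_mul, ← mul_assoc, classSum_commute, mul_assoc, ha, mul_smul_comm]

instance finite_monoidAlgebra : Module.Finite ℂ (MonoidAlgebra ℂ (Equiv.Perm (Fin n))) :=
  Module.Finite.equiv (MonoidAlgebra.coeffLinearEquiv ℂ).symm

theorem finrank_monoidAlgebra :
    Module.finrank ℂ (MonoidAlgebra ℂ (Equiv.Perm (Fin n))) = n ! := by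
  rw [(MonoidAlgebra.coeffLinearEquiv (S := ℂ) (M := Equiv.Perm (Fin n)) ℂ).finrank_eq,
    Module.finrank_finsupp_self, Fintype.card_perm, Fintype.card_fin]

/-- The inclusion of the Specht module in the group algebra as a `ℂ`-linear map. -/
noncomputable def spechtInclusion (μ : n.Partition) :
    SpechtModule μ →ₗ[ℂ] MonoidAlgebra ℂ (Equiv.Perm (Fin n)) :=
  (SpechtModule μ).subtype.restrictScalars ℂ

theorem spechtInclusion_injective (μ : n.Partition) : Function.Injective (spechtInclusion μ) :=
  Subtype.val_injective

instance finite_spechtModule : Module.Finite ℂ (SpechtModule μ) :=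
  Module.Finite.of_injective (spechtInclusion μ) (spechtInclusion_injective μ)

theorem spechtDim_le_factorial (μ : n.Partition) : spechtDim μ ≤ n ! := by
  rw [← finrank_monoidAlgebra]
  exact LinearMap.finrank_le_finrank_of_injective (spechtInclusion_injective μ)

theorem spechtDim_pos (μ : n.Partition) : 0 < spechtDim μ := by
  have : Nontrivial (SpechtModule μ) :=
    ⟨⟨youngSymmetrizer μ, Submodule.mem_span_singleton_self _⟩, 0,
      fun h => youngSymmetrizer_ne_zero (congrArg Subtype.val h)⟩
  exact Module.finrank_pos

/-- The central character `χ^μ(C_ν) |C_ν| / dim S^μ` is an integer of absolute value at most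
`|C_ν|`. -/
theorem exists_int_centralCharacter (μ ν : n.Partition) :
    ∃ a : ℤ, charValue μ ν * ((conjClass ν).card : ℂ) / (spechtDim μ : ℂ) = a ∧
      |a| ≤ (conjClass ν).card := by
  obtain ⟨a, ha, hle⟩ := exists_int_classSum_mul_youngSymmetrizer μ ν
  refine ⟨a, ?_, hle⟩
  have hsum : ∑ g ∈ conjClass ν, specht μ g = (a : ℂ) • LinearMap.id := by
    refine LinearMap.ext fun x => spechtInclusion_injective μ ?_
    have h := classSum_mul_of_mem ha x.2
    rw [classSum, Finset.sum_mul] at h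
    rw [LinearMap.sum_apply, map_sum, LinearMap.smul_apply, map_smul]
    exact h
  -- The trace turns the scalar action into `|C_ν| χ^μ(C_ν) = a dim S^μ`.
  have htr := congrArg (LinearMap.trace ℂ (SpechtModule μ)) hsum
  have hchar : ∑ g ∈ conjClass ν, LinearMap.trace ℂ (SpechtModule μ) (specht μ g) =
      (conjClass ν).card * charValue μ ν := by
    rw [← nsmul_eq_mul, ← Finset.sum_const]
    exact Finset.sum_congr rfl fun g hg => charValue_eq μ ν hg
  rw [map_sum, map_smul, LinearMap.trace_id, smul_eq_mul, hchar] at htr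
  rw [div_eq_iff (by exact_mod_cast (spechtDim_pos μ).ne'), mul_comm, htr, spechtDim]

theorem sum_card_conjClass_le (n : ℕ) : ∑ ν : n.Partition, (conjClass ν).card ≤ n ! := by
  classical
  rw [← Finset.card_biUnion]
  · exact (Finset.card_le_univ _).trans_eq (by rw [Fintype.card_perm, Fintype.card_fin])
  · intro ν _ ν' _ hne
    refine Finset.disjoint_left.2 fun g hg hg' => hne ?_
    simp only [conjClass, Finset.mem_filter, Finset.mem_univ, true_and] at hg hg'
    exact Nat.Partition.ext (hg.symm.trans hg')

end Specht

/-! ### Integral polynomials with a majorant -/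

open MvPolynomial

section Majorant

variable {σ : Type*}

/-- `P` has integer coefficients, bounded in absolute value by the coefficients of `Q`. -/
def Majorizes (Q : MvPolynomial σ ℕ) (P : MvPolynomial σ ℂ) : Prop :=
  ∀ m, ∃ a : ℤ, coeff m P = a ∧ |a| ≤ coeff m Q

theorem Majorizes.add {Q₁ Q₂ : MvPolynomial σ ℕ} {P₁ P₂ : MvPolynomial σ ℂ}
    (h₁ : Majorizes Q₁ P₁) (h₂ : Majorizes Q₂ P₂) : Majorizes (Q₁ + Q₂) (P₁ + P₂) := by
  intro m
  obtain ⟨a, ha, ha'⟩ := h₁ m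
  obtain ⟨b, hb, hb'⟩ := h₂ m
  refine ⟨a + b, by rw [coeff_add, ha, hb, Int.cast_add], (abs_add_le _ _).trans ?_⟩
  rw [coeff_add, Nat.cast_add]
  exact add_le_add ha' hb'

theorem Majorizes.mul {Q₁ Q₂ : MvPolynomial σ ℕ} {P₁ P₂ : MvPolynomial σ ℂ}
    (h₁ : Majorizes Q₁ P₁) (h₂ : Majorizes Q₂ P₂) : Majorizes (Q₁ * Q₂) (P₁ * P₂) := by
  classical
  intro m
  choose f hf hf' using h₁
  choose g hg hg' using h₂
  refine ⟨∑ x ∈ Finset.HasAntidiagonal.antidiagonal m, f x.1 * g x.2, ?_,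
    (Finset.abs_sum_le_sum_abs _ _).trans ?_⟩
  · rw [coeff_mul]
    push_cast
    exact Finset.sum_congr rfl fun x _ => by rw [hf, hg]
  · rw [coeff_mul]
    push_cast
    refine Finset.sum_le_sum fun x _ => ?_
    rw [abs_mul]
    exact mul_le_mul (hf' _) (hg' _) (abs_nonneg _) (Nat.cast_nonneg _)

theorem majorizes_zero : Majorizes (0 : MvPolynomial σ ℕ) 0 := fun _ => ⟨0, by simp⟩

theorem majorizes_one : Majorizes (1 : MvPolynomial σ ℕ) 1 := by
  classical
  intro m
  refine ⟨if 0 = m then 1 else 0, ?_, ?_⟩ <;> rw [coeff_one] <;> split_ifs <;> simp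

theorem majorizes_C {a : ℤ} {b : ℕ} (h : |a| ≤ b) :
    Majorizes (C b : MvPolynomial σ ℕ) (C (a : ℂ)) := by
  classical
  intro m
  refine ⟨if 0 = m then a else 0, ?_, ?_⟩ <;> rw [coeff_C] <;> split_ifs <;> simp [h]

theorem majorizes_X (i : σ) : Majorizes (X i : MvPolynomial σ ℕ) (X i) := by
  classical
  intro m
  refine ⟨if Finsupp.single i 1 = m then 1 else 0, ?_, ?_⟩ <;> rw [coeff_X] <;> split_ifs <;> simp

theorem majorizes_sum {ι : Type*} (s : Finset ι) {Q : ι → MvPolynomial σ ℕ}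
    {P : ι → MvPolynomial σ ℂ} (h : ∀ i ∈ s, Majorizes (Q i) (P i)) :
    Majorizes (∑ i ∈ s, Q i) (∑ i ∈ s, P i) := by
  classical
  induction s using Finset.induction_on with
  | empty => exact majorizes_zero
  | insert i s hi ih =>
    rw [Finset.sum_insert hi, Finset.sum_insert hi]
    exact (h i (by simp)).add (ih fun j hj => h j (by simp [hj]))

theorem majorizes_multiset_prod {ι : Type*} (s : Multiset ι) {Q : ι → MvPolynomial σ ℕ}
    {P : ι → MvPolynomial σ ℂ} (h : ∀ i ∈ s, Majorizes (Q i) (P i)) :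
    Majorizes (s.map Q).prod (s.map P).prod := by
  induction s using Multiset.induction_on with
  | empty => exact majorizes_one
  | cons i s ih =>
    rw [Multiset.map_cons, Multiset.map_cons, Multiset.prod_cons, Multiset.prod_cons]
    exact (h i (by simp)).mul (ih fun j hj => h j (by simp [hj]))

/-- The value at all ones is the sum of the coefficients, and these are natural numbers. -/
theorem coeff_le_eval_one (Q : MvPolynomial σ ℕ) (m : σ →₀ ℕ) :
    coeff m Q ≤ eval (fun _ => 1) Q := by
  rw [eval_eq]
  by_cases hm : m ∈ Q.support
  · simpa using Finset.single_le_sum (f := fun m => coeff m Q) (fun _ _ => Nat.zero_le _) hm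
  · rw [notMem_support_iff.1 hm]
    exact Nat.zero_le _

end Majorant

variable {d : ℕ}

/-- The majorant of `sPoly` obtained by replacing central characters by class sizes. -/
noncomputable def sMajorant (k : ℕ) (ω : SecondaryPartition d) (i : Fin k) :
    MvPolynomial (Fin k × ℕ) ℕ :=
  (ω.parts.map fun p => ∑ ν : p.1.Partition,
    C (conjClass ν).card * (ν.parts.map fun a => X (i, a)).prod).prod

theorem majorizes_sPoly (k : ℕ) (ω : SecondaryPartition d) (i : Fin k) :
    Majorizes (sMajorant k ω i) (sPoly k ω i) := by
  refine majorizes_multiset_prod _ fun p _ => majorizes_sum _ fun ν _ => ?_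
  obtain ⟨a, ha, hle⟩ := exists_int_centralCharacter p.2 ν
  rw [ha]
  exact (majorizes_C hle).mul (majorizes_multiset_prod _ fun a _ => majorizes_X _)

/-- `∏_j d_j!` for a secondary partition with parts `μ_j ⊢ d_j`. -/
def factorialProd (ω : SecondaryPartition d) : ℕ := (ω.parts.map fun p => p.1 !).prod

theorem multiset_prod_factorial_dvd_factorial_sum (s : Multiset ℕ) :
    (s.map fun a => a !).prod ∣ (s.sum)! := by
  induction s using Multiset.induction_on with
  | empty => simp
  | cons a s ih =>
    rw [Multiset.map_cons, Multiset.prod_cons, Multiset.sum_cons]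
    exact (mul_dvd_mul_left _ ih).trans (Nat.factorial_mul_factorial_dvd_factorial_add _ _)

theorem factorialProd_dvd (ω : SecondaryPartition d) : factorialProd ω ∣ d ! := by
  have h := multiset_prod_factorial_dvd_factorial_sum (ω.parts.map Sigma.fst)
  rwa [ω.sum_eq, Multiset.map_map] at h

theorem factorialProd_pos (ω : SecondaryPartition d) : 0 < factorialProd ω :=
  Nat.pos_of_dvd_of_pos (factorialProd_dvd ω) (Nat.factorial_pos d)

theorem multiset_prod_map_le {ι : Type*} (s : Multiset ι) {f g : ι → ℕ}
    (h : ∀ i ∈ s, f i ≤ g i) : (s.map f).prod ≤ (s.map g).prod := by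
  induction s using Multiset.induction_on with
  | empty => simp
  | cons i s ih =>
    rw [Multiset.map_cons, Multiset.map_cons, Multiset.prod_cons, Multiset.prod_cons]
    exact Nat.mul_le_mul (h i (by simp)) (ih fun j hj => h j (by simp [hj]))

/-- At all ones, the factor of `μ_j` becomes a sum of sizes of disjoint classes in `S_{d_j}`, at
most `d_j!`. -/
theorem eval_sMajorant_le (k : ℕ) (ω : SecondaryPartition d) (i : Fin k) :
    eval (fun _ => 1) (sMajorant k ω i) ≤ factorialProd ω := by
  rw [sMajorant, map_multiset_prod, Multiset.map_map]
  refine multiset_prod_map_le _ fun p _ => ?_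
  rw [Function.comp_apply, map_sum]
  refine le_trans (le_of_eq (Finset.sum_congr rfl fun ν _ => ?_)) (sum_card_conjClass_le p.1)
  rw [map_mul, eval_C, map_multiset_prod, Multiset.map_map]
  simp

/-- Every coefficient of `∏_i s(ω; t_i)` is an integer of absolute value at most `(d!)^k`. -/
theorem exists_int_coeff_prod_sPoly (k : ℕ) (ω : SecondaryPartition d) (m : Fin k × ℕ →₀ ℕ) :
    ∃ a : ℤ, coeff m (∏ i : Fin k, sPoly k ω i) = a ∧ |a| ≤ ((d ! : ℕ) : ℤ) ^ k := by
  obtain ⟨a, ha, hle⟩ :=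
    majorizes_multiset_prod Finset.univ.val (fun i _ => majorizes_sPoly k ω i) m
  refine ⟨a, ha, hle.trans ?_⟩
  have h : coeff m (∏ i : Fin k, sMajorant k ω i) ≤ (d !) ^ k := by
    refine (coeff_le_eval_one _ _).trans ?_
    rw [map_prod]
    refine (Finset.prod_le_pow_card _ _ (d !) fun i _ => ?_).trans_eq (by simp)
    exact (eval_sMajorant_le k ω i).trans
      (Nat.le_of_dvd (Nat.factorial_pos d) (factorialProd_dvd ω))
  exact_mod_cast h

/-! ### The coefficient `r(ω)` -/

theorem card_parts_le (ω : SecondaryPartition d) : Multiset.card ω.parts ≤ d := by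
  have h := Multiset.card_nsmul_le_sum (s := ω.parts.map Sigma.fst) (a := 1) (by
    intro x hx
    obtain ⟨q, hq, rfl⟩ := Multiset.mem_map.1 hx
    exact ω.pos q hq)
  simpa [ω.sum_eq] using h

theorem card_parts_pos (hd : 0 < d) (ω : SecondaryPartition d) : 0 < Multiset.card ω.parts := by
  refine Multiset.card_pos.2 fun h => ?_
  have := ω.sum_eq
  rw [h] at this
  simp at this
  omega

theorem multinomial_div_eq {α : Type*} [DecidableEq α] (s : Multiset α) :
    ((Multiset.card s)! : ℂ) / ∏ p ∈ s.toFinset, ((Multiset.count p s)! : ℂ) =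
      Nat.multinomial s.toFinset (fun p => Multiset.count p s) := by
  have h := Nat.multinomial_spec s.toFinset (fun p => Multiset.count p s)
  rw [Multiset.toFinset_sum_count_eq] at h
  rw [← h]
  push_cast
  refine mul_div_cancel_left₀ _ (Finset.prod_ne_zero_iff.2 fun p _ => ?_)
  exact_mod_cast (Nat.factorial_pos _).ne'

theorem multinomial_le_factorial {α : Type*} [DecidableEq α] (s : Multiset α) :
    Nat.multinomial s.toFinset (fun p => Multiset.count p s) ≤ (Multiset.card s)! := by
  rw [Nat.multinomial, Multiset.toFinset_sum_count_eq]
  exact Nat.div_le_self _ _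

/-- `∏_j dim S^{μ_j}`. -/
noncomputable def dimProd (ω : SecondaryPartition d) : ℕ :=
  (ω.parts.map fun p => spechtDim p.2).prod

theorem dimProd_le (ω : SecondaryPartition d) : dimProd ω ≤ factorialProd ω :=
  multiset_prod_map_le _ fun p _ => spechtDim_le_factorial p.2

theorem prod_sq_div_eq (ω : SecondaryPartition d) :
    (ω.parts.map fun p => ((spechtDim p.2 : ℂ) / (p.1 ! : ℂ)) ^ 2).prod =
      ((dimProd ω : ℂ) / (factorialProd ω : ℂ)) ^ 2 := by
  rw [Multiset.prod_map_pow, Multiset.prod_map_div, dimProd, factorialProd,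
    Nat.cast_multiset_prod, Nat.cast_multiset_prod, Multiset.map_map, Multiset.map_map]
  rfl

/-- `r(ω)` is an integer over `(d!)^4`, with numerator of absolute value at most `(d!)^5`. -/
theorem exists_int_rCoeff (hd : 0 < d) (ω : SecondaryPartition d) :
    ∃ a : ℤ, rCoeff ω = (a : ℂ) / ((d ! : ℕ) : ℂ) ^ 4 ∧ |a| ≤ ((d ! : ℕ) : ℤ) ^ 5 := by
  set n := Multiset.card ω.parts with hn
  obtain ⟨u, hu⟩ : n ∣ d ! := Nat.dvd_factorial (card_parts_pos hd ω) (card_parts_le ω)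
  obtain ⟨v, hv⟩ := factorialProd_dvd ω
  set K := Nat.multinomial ω.parts.toFinset (fun p => Multiset.count p ω.parts) with hK
  have hn0 : 0 < n := card_parts_pos hd ω
  have hM0 := factorialProd_pos ω
  have hKle : K ≤ d ! :=
    (multinomial_le_factorial ω.parts).trans (Nat.factorial_le (card_parts_le ω))
  have hule : u ≤ d ! := by
    rw [hu]
    exact Nat.le_mul_of_pos_left _ hn0
  have hDle : dimProd ω * v ≤ d ! := by
    rw [hv]
    exact Nat.mul_le_mul_right _ (dimProd_le ω)
  -- Here `u = d!/n` and `v = d!/∏ d_j!`. Clearing `1/n` costs one factor `d!` and the square two;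
  -- the trailing `d !` pads the denominator to `(d!)^4`.
  refine ⟨(-1) ^ (n - 1) * ((K * u * (dimProd ω * v) ^ 2 * d ! : ℕ) : ℤ), ?_, ?_⟩
  · have hn' : (n : ℂ) ≠ 0 := by exact_mod_cast hn0.ne'
    have hM' : (factorialProd ω : ℂ) ≠ 0 := by exact_mod_cast hM0.ne'
    have hd' : ((d ! : ℕ) : ℂ) ≠ 0 := by exact_mod_cast (Nat.factorial_pos d).ne'
    have hu' : ((d ! : ℕ) : ℂ) = n * u := by exact_mod_cast hu
    have hv' : ((d ! : ℕ) : ℂ) = factorialProd ω * v := by exact_mod_cast hv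
    have e1 : (1 : ℂ) / n = u / (d ! : ℕ) := by
      rw [div_eq_div_iff hn' hd', hu']
      ring
    have e2 : (dimProd ω : ℂ) / factorialProd ω = dimProd ω * v / (d ! : ℕ) := by
      rw [div_eq_div_iff hM' hd', hv']
      ring
    have e0 : rCoeff ω = (-1) ^ (n - 1) * (1 / (n : ℂ)) * (K : ℂ) *
        ((dimProd ω : ℂ) / (factorialProd ω : ℂ)) ^ 2 := by
      rw [rCoeff, prod_sq_div_eq, ← hn, hK, ← multinomial_div_eq, ← hn]
      ring
    rw [e0, e1, e2]
    push_cast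
    field_simp
  · rw [abs_mul, abs_pow, abs_neg, abs_one, one_pow, one_mul, Nat.abs_cast]
    have h : K * u * (dimProd ω * v) ^ 2 * d ! ≤ d ! * d ! * (d !) ^ 2 * d ! := by gcongr
    have e : d ! * d ! * (d !) ^ 2 * d ! = (d !) ^ 5 := by ring
    rw [e] at h
    exact_mod_cast h

end Hurwitz

theorem mainTheorem2 (d : ℕ) (hd : 0 < d) (m : Fin 3 × ℕ →₀ ℕ) :
    ∃ N : ℤ,
      MvPolynomial.coeff m (Hurwitz.realizabilityPoly d 3) = (N : ℂ) / ((d ! : ℕ) : ℂ) ^ 4 ∧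
      |N| ≤ (Hurwitz.p₂ d : ℤ) * ((d ! : ℕ) : ℤ) ^ 8 := by
  choose r hr hr' using Hurwitz.exists_int_rCoeff hd
  choose s hs hs' using fun ω : Hurwitz.SecondaryPartition d =>
    Hurwitz.exists_int_coeff_prod_sPoly 3 ω m
  refine ⟨∑ ω, r ω * s ω, ?_, (Finset.abs_sum_le_sum_abs _ _).trans ?_⟩
  · rw [Hurwitz.realizabilityPoly, MvPolynomial.coeff_sum]
    push_cast
    rw [Finset.sum_div]
    refine Finset.sum_congr rfl fun ω _ => ?_
    rw [MvPolynomial.coeff_C_mul, hr, hs]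
    ring
  · rw [Hurwitz.p₂, Nat.card_eq_fintype_card, ← nsmul_eq_mul, ← Finset.card_univ]
    refine Finset.sum_le_card_nsmul _ _ _ fun ω _ => ?_
    -- The exponent 8 splits as 5 from `r(ω)` and 3 from the three branch points.
    rw [abs_mul, pow_add (((d ! : ℕ) : ℤ)) 5 3]
    exact mul_le_mul (hr' ω) (hs' ω) (abs_nonneg _) (by positivity)
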